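/- Let $s\ge 1$, $n\ge 2$, $L\ge 2$ be integers and $d=sn$. Let $\Omega=\Omega_{\rm block}^{(s,n)}=\bigcup_{b=1}^n\{(i,j): i,j\in\{(b-1)s+1,\dots,bs\}\}$, and let $W^*\in\mathbb R^{d\times d}$ satisfy $W^*_{ij}=w^*>0$ for all $(i,j)\in\Omega$. For $A\in\mathbb R^{d\times d}$ put $\ell(A;\Omega)=\tfrac12\sum_{(i,j)\in\Omega}(A_{ij}-W^*_{ij})^2$. Write $W_{L:1}=W_L W_{L-1}\cdots W_1$ for $W_1,\dots,W_L\in\mathbb R^{d\times d}$ and consider the gradient flow $$\dot W_l(t)=-\frac{\partial}{\partial W_l}\,\ell\big(W_L(t)\cdots W_1(t);\Omega\big),\qquad 1\le l\le L,\ t\ge 0 .$$ Let $\alpha>0$ and $1<m\le\infty$. Every factor is initialized at the same matrix: if $m<\infty$, $W_l(0)$ has all diagonal entries equal to $\alpha$ and all off-diagonal entries equal to $\alpha/m$; if $m=\infty$, $W_l(0)=\alpha I_d$. Then the gradient flow with this initialization has a solution on $[0,\infty)$, and for every such solution $\ell(W_{L:1}(t);\Omega)\to 0$ as $t\to\infty$,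 the limit $W_{L:1}(\infty)=\lim_{t\to\infty}W_{L:1}(t)$ exists, $\ell(W_{L:1}(\infty);\Omega)=0$, and the singular values $\sigma_1\ge\sigma_2\ge\dots\ge\sigma_d$ of $W_{L:1}(\infty)$ satisfy $\sigma_j=0$ for all $j>n$ together with the following. 1. If $L=2$ and $m<\infty$, then for all $i\in\{2,\dots,n\}$ $$\sigma_1=\frac{w^*d\,(m+d-1)^2}{(m+d-1)^2+(n-1)(m-1)^2},\qquad \sigma_i=\frac{w^*d\,(m-1)^2}{(m+d-1)^2+(n-1)(m-1)^2}.$$ 2. If $L\ge3$ and $m<\infty$, then for all $i\in\{2,\dots,n\}$ one has $0<\sigma_1<w^*d$, $0<(n-1)\sigma_i<w^*d$, and $$\sigma_1^{\frac{2-L}{L}}-\Big(\frac{w^*d-\sigma_1}{n-1}\Big)^{\frac{2-L}{L}}=C_{\alpha,m,L,d},\qquad \big(w^*d-(n-1)\sigma_i\big)^{\frac{2-L}{L}}-\sigma_i^{\frac{2-L}{L}}=C_{\alpha,m,L,d},$$ where $C_{\alpha,m,L,d}=\big(\tfrac{\alpha}{m}\big)^{2-L}\big((m+d-1)^{2-L}-(m-1)^{2-L}\big)$.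 3. If $m=\infty$, then $\sigma_1=\dots=\sigma_n=s\,w^*$. -/

import Mathlib

open Filter Topology

noncomputable section

namespace DeepMatrixFactorization

/-- The end-to-end matrix `W_L W_{L-1} ⋯ W_1` of a depth-`L` factorization.
The factor `W_{l+1}` is stored at index `l : Fin L`. -/
def endToEnd {d L : ℕ} (W : Fin L → Matrix (Fin d) (Fin d) ℝ) : Matrix (Fin d) (Fin d) ℝ :=
  (List.ofFn W).reverse.prod

/-- The squared-error loss `ℓ(A; Ω) = 1/2 ∑_{(i,j) ∈ Ω} (A_{ij} - W*_{ij})²` over the observed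
entries `Ω` of the ground truth matrix `Wstar`. -/
def loss {d : ℕ} (Ω : Finset (Fin d × Fin d)) (Wstar A : Matrix (Fin d) (Fin d) ℝ) : ℝ :=
  (1 / 2) * ∑ p ∈ Ω, (A p.1 p.2 - Wstar p.1 p.2) ^ 2

/-- The training objective `φ(W_1, …, W_L; Ω) = ℓ(W_L ⋯ W_1; Ω)`. -/
def objective {d L : ℕ} (Ω : Finset (Fin d × Fin d)) (Wstar : Matrix (Fin d) (Fin d) ℝ)
    (W : Fin L → Matrix (Fin d) (Fin d) ℝ) : ℝ :=
  loss Ω Wstar (endToEnd W)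

/-- The matrix `∂φ/∂W_l` of partial derivatives of the objective with respect to the entries of the
`l`-th factor. The objective is a polynomial in these entries, so the derivatives exist. -/
def objectiveGrad {d L : ℕ} (Ω : Finset (Fin d × Fin d)) (Wstar : Matrix (Fin d) (Fin d) ℝ)
    (W : Fin L → Matrix (Fin d) (Fin d) ℝ) (l : Fin L) : Matrix (Fin d) (Fin d) ℝ :=
  Matrix.of fun i j =>
    deriv (fun x : ℝ =>
      objective Ω Wstar (Function.update W l (W l + x • Matrix.single i j (1 : ℝ)))) 0

/-- `W` solves the gradient flow `dW_l/dt = -∂φ/∂W_l`, for every layer `l` and every time `t ≥ 0`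
(the derivative at `t = 0` is one-sided; the values of `W` at negative times are irrelevant). -/
def IsGradientFlow {d L : ℕ} (Ω : Finset (Fin d × Fin d)) (Wstar : Matrix (Fin d) (Fin d) ℝ)
    (W : ℝ → Fin L → Matrix (Fin d) (Fin d) ℝ) : Prop :=
  ∀ t : ℝ, 0 ≤ t → ∀ (l : Fin L) (i j : Fin d),
    HasDerivWithinAt (fun τ => W τ l i j) (-(objectiveGrad Ω Wstar (W t) l i j)) (Set.Ici 0) t

/-- The block-diagonal observation set: the union over the blocks `b = 0, …, n-1` of the index pairs
`(i, j)` with `i, j ∈ {b s, …, (b+1) s - 1}` (indices counted from `0`). -/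
def blockObs (d s n : ℕ) : Finset (Fin d × Fin d) :=
  Finset.univ.filter fun p =>
    ∃ b : Fin n, ((b : ℕ) * s ≤ (p.1 : ℕ) ∧ (p.1 : ℕ) < ((b : ℕ) + 1) * s) ∧
      ((b : ℕ) * s ≤ (p.2 : ℕ) ∧ (p.2 : ℕ) < ((b : ℕ) + 1) * s)

/-- The initial value of every factor: for finite `m`, diagonal entries `α` and off-diagonal
entries `α / m`; for `m = ∞`, the scaled identity `α I_d`. -/
def initFactor (d : ℕ) (α : ℝ) : WithTop ℝ → Matrix (Fin d) (Fin d) ℝ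
  | ⊤ => α • (1 : Matrix (Fin d) (Fin d) ℝ)
  | (m : ℝ) => Matrix.of fun i j => if i = j then α else α / m

/-- The `k`-th largest singular value of a real square matrix, counted from `k = 0` and with
multiplicity (the square roots of the eigenvalues of `Aᵀ A`, in decreasing order). -/
def singVal {d : ℕ} (A : Matrix (Fin d) (Fin d) ℝ) (k : ℕ) : ℝ :=
  (Matrix.toEuclideanLin A).singularValues k

/-- The constant `C_{α,m,L,d} = (α/m)^{2-L} ((m+d-1)^{2-L} - (m-1)^{2-L})`. -/
def couplingConst (α m : ℝ) (L d : ℕ) : ℝ :=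
  (α / m) ^ (2 - (L : ℤ)) * ((m + d - 1) ^ (2 - (L : ℤ)) - (m - 1) ^ (2 - (L : ℤ)))

end DeepMatrixFactorization

end

open Filter Topology

noncomputable section

namespace DeepMatrixFactorization

/-! The three matrices `meanProj`, `blockProj - meanProj` and `1 - blockProj` are mutually
orthogonal projections, and the initial factor is a combination `spec d s x y z` of them. Masking
the end-to-end error by the block pattern leads back into this commutative algebra (`masked_spec`),
so at equal factors of this form all layers have the same gradient, again of this form
(`objectiveGrad_spec`). With L = k + 2 and r the common error on the first two eigenspaces, the
matrix flow becomes x' = -x^(k+1) r, y' = -y^(k+1) r, z' = -z^(2k+3). The gradient field is C¹, so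
uniqueness makes every solution with this start equal to the reduced one.

For the reduced system, x, y, z, x - y and r each solve a scalar linear equation f' = a f, hence
keep their sign, and |r| does not grow. So x and y are bounded and monotone and converge; z
decreases to 0. A limit of the derivative must vanish, which forces r = 0 once the limit X is
positive. The conserved quantity, x/y for L = 2 and x⁻ᵏ - y⁻ᵏ for L ≥ 3, keeps the limit Y positive
and selects the limit on the curve X^L + (n-1) Y^L = w* d (`ReducedFlow.tendsto`).

The limit matrix has singular values X^L once, Y^L with multiplicity n - 1, and 0 otherwise
(`singVal_spec`); substituting the conserved quantity gives the three cases. -/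

/-! ### Ordinary differential equations with a continuously differentiable right-hand side -/

section ODE

open Set Metric

variable {E : Type*} [NormedAddCommGroup E] [NormedSpace ℝ E]

/-- A continuously differentiable map is Lipschitz on every closed ball of a proper space. -/
theorem exists_lipschitzOnWith_closedBall [ProperSpace E] {v : E → E} (hv : ContDiff ℝ 1 v)
    (x : E) (R : ℝ) : ∃ K, LipschitzOnWith K v (closedBall x R) :=
  hv.locallyLipschitz.locallyLipschitzOn.exists_lipschitzOnWith_of_compact
    (isCompact_closedBall x R)

/-- Two solutions of `γ' = v γ` on `[0, T]` with the same initial value agree. -/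
theorem eqOn_of_hasDerivWithinAt_Icc [ProperSpace E] {v : E → E} (hv : ContDiff ℝ 1 v) {T : ℝ}
    {f g : ℝ → E} (hf : ∀ t ∈ Icc 0 T, HasDerivWithinAt f (v (f t)) (Icc 0 T) t)
    (hg : ∀ t ∈ Icc 0 T, HasDerivWithinAt g (v (g t)) (Icc 0 T) t) (h0 : f 0 = g 0) :
    EqOn f g (Icc 0 T) := by
  have hfc : ContinuousOn f (Icc 0 T) := fun t ht => (hf t ht).continuousWithinAt
  have hgc : ContinuousOn g (Icc 0 T) := fun t ht => (hg t ht).continuousWithinAt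
  obtain ⟨R, hR⟩ := ((isCompact_Icc.image_of_continuousOn hfc).union
    (isCompact_Icc.image_of_continuousOn hgc)).isBounded.subset_closedBall (0 : E)
  obtain ⟨K, hK⟩ := exists_lipschitzOnWith_closedBall hv 0 R
  have hright : ∀ {u : ℝ → E}, (∀ t ∈ Icc 0 T, HasDerivWithinAt u (v (u t)) (Icc 0 T) t) →
      ∀ t ∈ Ico 0 T, HasDerivWithinAt u (v (u t)) (Ici t) t := fun hu t ht =>
    ((hu t (Ico_subset_Icc_self ht)).mono (Icc_subset_Icc_left ht.1)).mono_of_mem_nhdsWithin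
      (Icc_mem_nhdsGE ht.2)
  exact ODE_solution_unique_of_mem_Icc_right (v := fun _ => v) (s := fun _ => closedBall 0 R)
    (fun _ _ => hK) hfc (hright hf)
    (fun t ht => hR (Or.inl (mem_image_of_mem f (Ico_subset_Icc_self ht))))
    hgc (hright hg)
    (fun t ht => hR (Or.inr (mem_image_of_mem g (Ico_subset_Icc_self ht)))) h0

/-- A solution on `[0, T]` and a solution on `[T, T']` that match at `T` can be glued. -/
theorem hasDerivWithinAt_glue {v : E → E} {T T' : ℝ} (hT : 0 ≤ T) (hTT' : T ≤ T') {f g : ℝ → E}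
    (hf : ∀ t ∈ Icc 0 T, HasDerivWithinAt f (v (f t)) (Icc 0 T) t)
    (hg : ∀ t ∈ Icc T T', HasDerivWithinAt g (v (g t)) (Icc T T') t) (hfg : g T = f T) :
    ∀ t ∈ Icc 0 T', HasDerivWithinAt (fun τ => if τ ≤ T then f τ else g τ)
      (v (if t ≤ T then f t else g t)) (Icc 0 T') t := by
  intro t ht
  set h : ℝ → E := fun τ => if τ ≤ T then f τ else g τ
  have hhf : EqOn h f (Icc 0 T) := fun τ hτ => if_pos hτ.2
  have hhg : EqOn h g (Icc T T') := fun τ hτ => by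
    rcases hτ.1.eq_or_lt with rfl | hlt
    · simp [h, hfg]
    · exact if_neg hlt.not_ge
  change HasDerivWithinAt h (v (h t)) (Icc 0 T') t
  rw [← Icc_union_Icc_eq_Icc hT hTT']
  refine HasDerivWithinAt.union ?_ ?_
  · by_cases htT : t ∈ Icc 0 T
    · rw [hhf htT]
      exact (hf t htT).congr hhf (hhf htT)
    · exact HasFDerivWithinAt.of_notMem_closure (by rwa [closure_Icc])
  · by_cases htT : t ∈ Icc T T'
    · rw [hhg htT]
      exact (hg t htT).congr hhg (hhg htT)
    · exact HasFDerivWithinAt.of_notMem_closure (by rwa [closure_Icc])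

/-- If every solution of `γ' = v γ` with `γ 0 = x₀` on a bounded interval `[0, T]` stays in a fixed
ball, then a solution exists on `[0, ∞)`. -/
theorem exists_hasDerivWithinAt_Ici_of_bounded [ProperSpace E] {v : E → E} (hv : ContDiff ℝ 1 v)
    (x₀ : E) (R : ℝ)
    (hR : ∀ T, 0 ≤ T → ∀ f : ℝ → E, f 0 = x₀ →
      (∀ t ∈ Icc 0 T, HasDerivWithinAt f (v (f t)) (Icc 0 T) t) → ‖f T‖ ≤ R) :
    ∃ f : ℝ → E, f 0 = x₀ ∧ ∀ t, 0 ≤ t → HasDerivWithinAt f (v (f t)) (Ici 0) t := by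
  -- The extra 1 leaves a unit ball of room around every reachable point, so the length of the local
  -- existence interval can be chosen uniformly.
  obtain ⟨K, hK⟩ := exists_lipschitzOnWith_closedBall hv 0 (R + 1)
  obtain ⟨M, hM⟩ := (isCompact_closedBall (0 : E) (R + 1)).exists_bound_of_continuousOn
    hv.continuous.continuousOn
  set M' : NNReal := M.toNNReal
  set ε : ℝ := 1 / (M' + 1)
  have hε : 0 < ε := by positivity
  have step : ∀ T, 0 ≤ T → (∃ f : ℝ → E, f 0 = x₀ ∧
      ∀ t ∈ Icc 0 T, HasDerivWithinAt f (v (f t)) (Icc 0 T) t) →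
      ∃ f : ℝ → E, f 0 = x₀ ∧
        ∀ t ∈ Icc 0 (T + ε), HasDerivWithinAt f (v (f t)) (Icc 0 (T + ε)) t := by
    rintro T hT ⟨f, hf0, hf⟩
    have hfT := hR T hT f hf0 hf
    have hsub : closedBall (f T) ((1 : NNReal) : ℝ) ⊆ closedBall (0 : E) (R + 1) := by
      refine closedBall_subset_closedBall' ?_
      simp only [NNReal.coe_one, dist_zero_right]
      linarith
    have hPL : IsPicardLindelof (fun _ => v) (tmin := T) (tmax := T + ε)
        ⟨T, ⟨le_rfl, by linarith⟩⟩ (f T) 1 0 M' K := by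
      refine IsPicardLindelof.of_time_independent
        (fun x hx => (hM x (hsub hx)).trans (Real.le_coe_toNNReal M)) (hK.mono hsub) ?_
      simp only [add_sub_cancel_left, sub_self, NNReal.coe_one, NNReal.coe_zero, sub_zero]
      rw [max_eq_left hε.le]
      simp only [ε]
      rw [mul_one_div, div_le_one (by positivity)]
      linarith
    obtain ⟨g, hgT, hg⟩ := hPL.exists_eq_forall_mem_Icc_hasDerivWithinAt₀
    exact ⟨_, by simp [hT, hf0], hasDerivWithinAt_glue hT (by linarith) hf hg hgT⟩
  have hall : ∀ k : ℕ, ∃ f : ℝ → E, f 0 = x₀ ∧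
      ∀ t ∈ Icc 0 (k * ε), HasDerivWithinAt f (v (f t)) (Icc 0 (k * ε)) t := by
    intro k
    induction k with
    | zero =>
      refine ⟨fun _ => x₀, rfl, fun t ht => ?_⟩
      have : Icc (0 : ℝ) ((0 : ℕ) * ε) = {t} := by
        simp only [Nat.cast_zero, zero_mul, Icc_self] at ht ⊢
        rw [mem_singleton_iff.1 ht]
      rw [this]
      exact HasFDerivWithinAt.singleton
    | succ k ih =>
      have := step (k * ε) (by positivity) ih
      rwa [show ((k + 1 : ℕ) : ℝ) * ε = k * ε + ε by push_cast; ring]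
  choose F hF0 hF using hall
  have hagree : ∀ j k : ℕ, j ≤ k → EqOn (F j) (F k) (Icc 0 (j * ε)) := by
    intro j k hjk
    have hs : Icc 0 (j * ε) ⊆ Icc 0 (k * ε) := Icc_subset_Icc_right (by gcongr)
    exact eqOn_of_hasDerivWithinAt_Icc hv (hF j) (fun t ht => (hF k t (hs ht)).mono hs)
      ((hF0 j).trans (hF0 k).symm)
  have hidx : ∀ t : ℝ, t ≤ ⌈t / ε⌉₊ * ε := fun t => by
    have := Nat.le_ceil (t / ε)
    rwa [div_le_iff₀ hε] at this
  set f : ℝ → E := fun t => F ⌈t / ε⌉₊ t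
  have hf : ∀ k : ℕ, EqOn f (F k) (Icc 0 (k * ε)) := by
    intro k t ht
    rcases le_total ⌈t / ε⌉₊ k with h | h
    · exact hagree _ _ h ⟨ht.1, hidx t⟩
    · exact (hagree _ _ h ht).symm
  refine ⟨f, by simp [f, hF0], fun t ht => ?_⟩
  -- One step beyond the ceiling puts `t` strictly below `k * ε`, so the compact interval is a
  -- neighbourhood of `t` within `Ici 0`.
  set k := ⌈t / ε⌉₊ + 1
  have htk : t < k * ε := by
    have := hidx t
    simp only [k]
    push_cast
    linarith
  have htm : t ∈ Icc 0 (k * ε) := ⟨ht, htk.le⟩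
  rw [hf k htm]
  refine ((hF k t htm).congr (hf k) (hf k htm)).mono_of_mem_nhdsWithin ?_
  exact mem_nhdsWithin.2 ⟨Iio (k * ε), isOpen_Iio, htk, fun τ hτ => ⟨hτ.2, hτ.1.le⟩⟩

end ODE

/-! ### The reduced flow of the eigenvalues -/

section Reduced

open Set

theorem eq_of_hasDerivWithinAt_zero {T : ℝ} {f : ℝ → ℝ}
    (hf : ∀ t ∈ Icc 0 T, HasDerivWithinAt f 0 (Icc 0 T) t) :
    ∀ t ∈ Icc 0 T, f t = f 0 :=
  constant_of_derivWithin_zero (fun t ht => (hf t ht).differentiableWithinAt)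
    fun t ht => (hf t (Ico_subset_Icc_self ht)).derivWithin
      (uniqueDiffOn_Icc (ht.1.trans_lt ht.2) t (Ico_subset_Icc_self ht))

theorem exists_primitive {T : ℝ} (hT : 0 ≤ T) {a : ℝ → ℝ} (ha : ContinuousOn a (Icc 0 T)) :
    ∃ I : ℝ → ℝ, I 0 = 0 ∧ ∀ t ∈ Icc 0 T, HasDerivWithinAt I (a t) (Icc 0 T) t := by
  have hc : Continuous (IccExtend hT ((Icc 0 T).domRestrict a)) :=
    (continuousOn_iff_continuous_domRestrict.1 ha).Icc_extend'
  refine ⟨fun t => ∫ τ in (0 : ℝ)..t, IccExtend hT ((Icc 0 T).domRestrict a) τ, by simp,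
    fun t ht => ?_⟩
  have := (intervalIntegral.integral_hasStrictDerivAt_right (hc.intervalIntegrable 0 t)
    (hc.stronglyMeasurableAtFilter _ _) hc.continuousAt).hasDerivAt.hasDerivWithinAt (s := Icc 0 T)
  rwa [IccExtend_of_mem hT _ ht] at this

/-- Solutions of the scalar linear equation `f' = a f`. -/
theorem eq_mul_exp_of_linear {T : ℝ} {a f I : ℝ → ℝ} (hI0 : I 0 = 0)
    (hI : ∀ t ∈ Icc 0 T, HasDerivWithinAt I (a t) (Icc 0 T) t)
    (hf : ∀ t ∈ Icc 0 T, HasDerivWithinAt f (a t * f t) (Icc 0 T) t) :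
    ∀ t ∈ Icc 0 T, f t = f 0 * Real.exp (I t) := by
  intro t ht
  have h := eq_of_hasDerivWithinAt_zero (f := fun τ => f τ * Real.exp (-I τ)) (fun τ hτ => by
    convert! (hf τ hτ).mul (hI τ hτ).neg.exp using 1
    ring) t ht
  simp only [hI0, neg_zero, Real.exp_zero, mul_one] at h
  rw [← h, mul_assoc, ← Real.exp_add]
  simp

/-- The factor is the exponential of a primitive of `a`. Sign preservation in the reduced flow rests
on this. -/
theorem exists_pos_factor_of_linear {T : ℝ} (hT : 0 ≤ T) {a f : ℝ → ℝ}
    (ha : ContinuousOn a (Icc 0 T))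
    (hf : ∀ t ∈ Icc 0 T, HasDerivWithinAt f (a t * f t) (Icc 0 T) t) :
    ∃ e : ℝ, 0 < e ∧ f T = f 0 * e := by
  obtain ⟨I, hI0, hI⟩ := exists_primitive hT ha
  exact ⟨_, Real.exp_pos _, eq_mul_exp_of_linear hI0 hI hf T ⟨hT, le_rfl⟩⟩

theorem exists_factor_le_one_of_linear {T : ℝ} (hT : 0 ≤ T) {a f : ℝ → ℝ}
    (ha : ContinuousOn a (Icc 0 T)) (ha0 : ∀ t ∈ Icc 0 T, a t ≤ 0)
    (hf : ∀ t ∈ Icc 0 T, HasDerivWithinAt f (a t * f t) (Icc 0 T) t) :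
    ∃ e : ℝ, 0 < e ∧ e ≤ 1 ∧ f T = f 0 * e := by
  obtain ⟨I, hI0, hI⟩ := exists_primitive hT ha
  refine ⟨_, Real.exp_pos _, ?_, eq_mul_exp_of_linear hI0 hI hf T ⟨hT, le_rfl⟩⟩
  have hanti : AntitoneOn I (Icc 0 T) := by
    refine antitoneOn_of_hasDerivWithinAt_nonpos (f' := a) (convex_Icc 0 T)
      (fun t ht => (hI t ht).continuousWithinAt)
      (fun t ht => (hI t (interior_subset ht)).mono interior_subset)
      (fun t ht => ha0 t (interior_subset ht))
  have := hanti ⟨le_rfl, hT⟩ ⟨hT, le_rfl⟩ hT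
  rw [hI0] at this
  exact Real.exp_le_one_iff.2 this

/-- The mean of the top `N` eigenvalues of the product, minus its target value. -/
def residual (k : ℕ) (N c X Y : ℝ) : ℝ := (X ^ (k + 2) + (N - 1) * Y ^ (k + 2)) / N - c

/-- The gradient flow of `k + 2` equal factors, in terms of the eigenvalues of the factors. -/
structure ReducedFlow (k : ℕ) (N c : ℝ) (S : Set ℝ) (x y z : ℝ → ℝ) : Prop where
  x' : ∀ t ∈ S, HasDerivWithinAt x (-(x t ^ (k + 1) * residual k N c (x t) (y t))) S t
  y' : ∀ t ∈ S, HasDerivWithinAt y (-(y t ^ (k + 1) * residual k N c (x t) (y t))) S t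
  z' : ∀ t ∈ S, HasDerivWithinAt z (-(z t ^ (2 * k + 3))) S t

namespace ReducedFlow

variable {k : ℕ} {N c : ℝ} {S : Set ℝ} {x y z : ℝ → ℝ}

theorem mono {S' : Set ℝ} (h : ReducedFlow k N c S x y z) (hS : S' ⊆ S) :
    ReducedFlow k N c S' x y z :=
  ⟨fun t ht => (h.x' t (hS ht)).mono hS, fun t ht => (h.y' t (hS ht)).mono hS,
    fun t ht => (h.z' t (hS ht)).mono hS⟩

theorem continuousOn_x (h : ReducedFlow k N c S x y z) : ContinuousOn x S :=
  fun t ht => (h.x' t ht).continuousWithinAt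

theorem continuousOn_y (h : ReducedFlow k N c S x y z) : ContinuousOn y S :=
  fun t ht => (h.y' t ht).continuousWithinAt

theorem continuousOn_z (h : ReducedFlow k N c S x y z) : ContinuousOn z S :=
  fun t ht => (h.z' t ht).continuousWithinAt

theorem continuousOn_residual (h : ReducedFlow k N c S x y z) :
    ContinuousOn (fun t => residual k N c (x t) (y t)) S := by
  have hx := h.continuousOn_x
  have hy := h.continuousOn_y
  unfold residual
  fun_prop

/-- The chain rule reproduces the residual as a factor; its coefficient is nonpositive for N ≥ 1
because the exponents 2(k+1) are even. -/
theorem hasDerivWithinAt_residual (h : ReducedFlow k N c S x y z) {t : ℝ} (ht : t ∈ S) :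
    HasDerivWithinAt (fun t => residual k N c (x t) (y t))
      (-((k + 2) / N * (x t ^ (2 * (k + 1)) + (N - 1) * y t ^ (2 * (k + 1))))
        * residual k N c (x t) (y t)) S t := by
  unfold residual
  convert! ((((h.x' t ht).pow (k + 2)).add (((h.y' t ht).pow (k + 2)).const_mul (N - 1))).div_const
    N).sub_const c using 1
  simp only [residual, show k + 2 - 1 = k + 1 from rfl]
  push_cast
  ring

variable {T : ℝ}

theorem x_pos (h : ReducedFlow k N c (Icc 0 T) x y z) (hT : 0 ≤ T) (hx : 0 < x 0) : 0 < x T := by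
  have hxc := h.continuousOn_x
  have hrc := h.continuousOn_residual
  obtain ⟨e, he, hxe⟩ := exists_pos_factor_of_linear hT
    (a := fun t => -(x t ^ k * residual k N c (x t) (y t))) (f := x) (by fun_prop)
    (fun t ht => by convert h.x' t ht using 1; ring)
  rw [hxe]
  positivity

theorem y_pos (h : ReducedFlow k N c (Icc 0 T) x y z) (hT : 0 ≤ T) (hy : 0 < y 0) : 0 < y T := by
  have hyc := h.continuousOn_y
  have hrc := h.continuousOn_residual
  obtain ⟨e, he, hye⟩ := exists_pos_factor_of_linear hT
    (a := fun t => -(y t ^ k * residual k N c (x t) (y t))) (f := y) (by fun_prop)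
    (fun t ht => by convert h.y' t ht using 1; ring)
  rw [hye]
  positivity

theorem z_pos_le (h : ReducedFlow k N c (Icc 0 T) x y z) (hT : 0 ≤ T) (hz : 0 < z 0) :
    0 < z T ∧ z T ≤ z 0 := by
  have hzc := h.continuousOn_z
  obtain ⟨e, he, he1, hze⟩ := exists_factor_le_one_of_linear hT
    (a := fun t => -(z t ^ (2 * (k + 1)))) (f := z) (by fun_prop)
    (fun t ht => by simpa using Even.pow_nonneg (even_two_mul (k + 1)) (z t))
    (fun t ht => by convert h.z' t ht using 1; ring)
  rw [hze]
  exact ⟨by positivity, mul_le_of_le_one_right hz.le he1⟩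

/-- Since x - y divides x^(k+1) - y^(k+1), the difference x - y solves a linear equation and keeps
its sign. -/
theorem y_le_x (h : ReducedFlow k N c (Icc 0 T) x y z) (hT : 0 ≤ T) (hyx : y 0 ≤ x 0) :
    y T ≤ x T := by
  have hxc := h.continuousOn_x
  have hyc := h.continuousOn_y
  have hrc := h.continuousOn_residual
  obtain ⟨e, he, hxe⟩ := exists_pos_factor_of_linear hT
    (a := fun t => -(residual k N c (x t) (y t) *
      ∑ i ∈ Finset.range (k + 1), x t ^ i * y t ^ (k + 1 - 1 - i))) (f := fun t => x t - y t)
    (by fun_prop)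
    (fun t ht => by
      convert! (h.x' t ht).sub (h.y' t ht) using 1
      linear_combination -(residual k N c (x t) (y t)) *
        (Commute.all (x t) (y t)).geom_sum₂_mul (k + 1))
  nlinarith

theorem residual_factor (h : ReducedFlow k N c (Icc 0 T) x y z) (hT : 0 ≤ T) (hN : 1 ≤ N) :
    ∃ e : ℝ, 0 < e ∧ e ≤ 1 ∧
      residual k N c (x T) (y T) = residual k N c (x 0) (y 0) * e := by
  have hxc := h.continuousOn_x
  have hyc := h.continuousOn_y
  refine exists_factor_le_one_of_linear hT
    (a := fun t => -((k + 2) / N * (x t ^ (2 * (k + 1)) + (N - 1) * y t ^ (2 * (k + 1)))))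
    (by fun_prop) (fun t ht => ?_) (fun t ht => h.hasDerivWithinAt_residual ht)
  have h1 : 0 ≤ x t ^ (2 * (k + 1)) := Even.pow_nonneg (even_two_mul (k + 1)) (x t)
  have h2 : 0 ≤ y t ^ (2 * (k + 1)) := Even.pow_nonneg (even_two_mul (k + 1)) (y t)
  have h3 : 0 ≤ N - 1 := by linarith
  rw [neg_nonpos]
  positivity

/-- An explicit bound on the larger eigenvalue. -/
theorem x_le (h : ReducedFlow k N c (Icc 0 T) x y z) (hT : 0 ≤ T) (hN : 1 ≤ N)
    (hx : 0 < x 0) (hy : 0 < y 0) :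
    x T ≤ 1 + N * (|residual k N c (x 0) (y 0)| + |c|) := by
  obtain ⟨e, he, he1, hr⟩ := h.residual_factor hT hN
  have hxT := h.x_pos hT hx
  have hyT := h.y_pos hT hy
  have hle : residual k N c (x T) (y T) ≤ |residual k N c (x 0) (y 0)| := by
    refine (le_abs_self _).trans ?_
    rw [hr, abs_mul, abs_of_pos he]
    exact mul_le_of_le_one_right (abs_nonneg _) he1
  have hpow : x T ^ (k + 2) ≤ N * (|residual k N c (x 0) (y 0)| + |c|) := by
    have h1 : (x T ^ (k + 2) + (N - 1) * y T ^ (k + 2)) / N ≤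
        |residual k N c (x 0) (y 0)| + |c| := by
      have := le_abs_self c
      rw [residual] at hle
      linarith
    rw [div_le_iff₀ (by linarith)] at h1
    have h2 : 0 ≤ (N - 1) * y T ^ (k + 2) := mul_nonneg (by linarith) (by positivity)
    linarith
  -- Either x ≤ 1 or x ≤ x^(k+2); this avoids taking a root of the bound.
  rcases le_total (x T) 1 with h1 | h1
  · have : 0 ≤ x T ^ (k + 2) := by positivity
    linarith
  · have := le_self_pow₀ h1 (show k + 2 ≠ 0 by omega)
    linarith

/-- For two factors the ratio of the eigenvalues is conserved. -/
theorem ratio_eq (h : ReducedFlow 0 N c (Icc 0 T) x y z) (hT : 0 ≤ T) :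
    x T * y 0 = x 0 * y T := by
  obtain ⟨I, hI0, hI⟩ := exists_primitive hT h.continuousOn_residual.neg
  have hx := eq_mul_exp_of_linear hI0 hI (f := x)
    (fun t ht => by convert h.x' t ht using 1; simp; ring) T ⟨hT, le_rfl⟩
  have hy := eq_mul_exp_of_linear hI0 hI (f := y)
    (fun t ht => by convert h.y' t ht using 1; simp; ring) T ⟨hT, le_rfl⟩
  rw [hx, hy]
  ring

/-- For `k + 2` factors with `k ≥ 1` the difference `x⁻ᵏ - y⁻ᵏ` is conserved. -/
theorem inv_pow_sub_inv_pow_eq (h : ReducedFlow k N c (Icc 0 T) x y z) (hT : 0 ≤ T)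
    (hx : 0 < x 0) (hy : 0 < y 0) :
    (x T ^ k)⁻¹ - (y T ^ k)⁻¹ = (x 0 ^ k)⁻¹ - (y 0 ^ k)⁻¹ := by
  refine eq_of_hasDerivWithinAt_zero (f := fun t => (x t ^ k)⁻¹ - (y t ^ k)⁻¹) (fun t ht => ?_)
    T ⟨hT, le_rfl⟩
  have ht' := h.mono (Icc_subset_Icc_right ht.2)
  have hxt := ht'.x_pos ht.1 hx
  have hyt := ht'.y_pos ht.1 hy
  -- Both inverse powers have derivative k times the residual.
  convert! (((h.x' t ht).pow k).inv (pow_pos hxt k).ne').sub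
    (((h.y' t ht).pow k).inv (pow_pos hyt k).ne') using 1
  rcases k with _ | k
  · simp
  · simp only [Nat.add_sub_cancel, Pi.pow_apply]
    field_simp
    ring

end ReducedFlow

/-- If a function and its derivative converge at infinity, then the derivative tends to zero. -/
theorem eq_zero_of_tendsto_of_tendsto_deriv {f f' : ℝ → ℝ} {a b : ℝ}
    (hf : ∀ t, 0 ≤ t → HasDerivWithinAt f (f' t) (Ici 0) t)
    (ha : Tendsto f atTop (𝓝 a)) (hb : Tendsto f' atTop (𝓝 b)) : b = 0 := by
  -- The mean value theorem on [t, t+1]: the increments of `f` tend to 0 and are values of `f'` at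
  -- points going to infinity.
  have hξ : ∀ t : ℝ, ∃ ξ, t ≤ ξ ∧ (0 ≤ t → f (t + 1) - f t = f' ξ) := by
    intro t
    by_cases ht : 0 ≤ t
    · obtain ⟨ξ, hξ, h⟩ := exists_hasDerivAt_eq_slope f f' (show t < t + 1 by linarith)
        (fun τ hτ => ((hf τ (ht.trans hτ.1)).mono
          fun u hu => ht.trans hu.1).continuousWithinAt)
        (fun τ hτ => (hf τ (ht.trans hτ.1.le)).hasDerivAt (Ici_mem_nhds (ht.trans_lt hτ.1)))
      exact ⟨ξ, hξ.1.le, fun _ => by rw [h]; simp⟩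
    · exact ⟨t, le_rfl, fun h => absurd h ht⟩
  choose ξ hle hξ using hξ
  have h1 : Tendsto (fun t => f' (ξ t)) atTop (𝓝 b) :=
    hb.comp (tendsto_atTop_mono hle tendsto_id)
  have h2 : Tendsto (fun t => f (t + 1) - f t) atTop (𝓝 (a - a)) :=
    (ha.comp (tendsto_atTop_add_const_right _ 1 tendsto_id)).sub ha
  rw [sub_self] at h2
  exact tendsto_nhds_unique (h1.congr' ((eventually_ge_atTop 0).mono fun t ht => (hξ t ht).symm)) h2

/-- A bounded function on `[0, ∞)` whose derivative has constant sign converges at infinity. -/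
theorem exists_tendsto_of_deriv_nonneg {f f' : ℝ → ℝ} {B : ℝ}
    (hf : ∀ t, 0 ≤ t → HasDerivWithinAt f (f' t) (Ici 0) t) (h0 : ∀ t, 0 ≤ t → 0 ≤ f' t)
    (hB : ∀ t, 0 ≤ t → f t ≤ B) : ∃ a, f 0 ≤ a ∧ Tendsto f atTop (𝓝 a) := by
  have hmono : MonotoneOn f (Ici 0) := monotoneOn_of_hasDerivWithinAt_nonneg (convex_Ici 0)
    (fun t ht => (hf t ht).continuousWithinAt)
    (fun t ht => (hf t (interior_subset ht)).mono interior_subset)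
    (fun t ht => h0 t (interior_subset ht))
  have hmono' : Monotone fun t => f (max t 0) := fun s t hst =>
    hmono (le_max_right s 0) (le_max_right t 0) (max_le_max_right 0 hst)
  have hbdd : BddAbove (range fun t => f (max t 0)) :=
    ⟨B, by rintro _ ⟨t, rfl⟩; exact hB _ (le_max_right t 0)⟩
  have hlim := (tendsto_atTop_ciSup hmono' hbdd).congr'
    ((eventually_ge_atTop 0).mono fun t ht => by rw [max_eq_left ht])
  refine ⟨_, ?_, hlim⟩
  exact ge_of_tendsto hlim ((eventually_ge_atTop 0).mono fun t ht => hmono self_mem_Ici ht ht)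

theorem exists_tendsto_of_deriv_nonpos {f f' : ℝ → ℝ} {B : ℝ}
    (hf : ∀ t, 0 ≤ t → HasDerivWithinAt f (f' t) (Ici 0) t) (h0 : ∀ t, 0 ≤ t → f' t ≤ 0)
    (hB : ∀ t, 0 ≤ t → B ≤ f t) : ∃ a, Tendsto f atTop (𝓝 a) := by
  obtain ⟨a, -, ha⟩ := exists_tendsto_of_deriv_nonneg (f := fun t => -f t) (f' := fun t => -f' t)
    (B := -B) (fun t ht => (hf t ht).neg) (fun t ht => by linarith [h0 t ht])
    (fun t ht => by linarith [hB t ht])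
  exact ⟨-a, by simpa using ha.neg⟩

/-- The constant sign of the residual makes x and y monotone, and boundedness gives limits.
Stationarity of the limit yields a zero residual only after X = 0 is excluded, and Y = 0 is excluded
by the conserved quantity. -/
theorem ReducedFlow.tendsto {k : ℕ} {N c : ℝ} {x y z : ℝ → ℝ}
    (h : ReducedFlow k N c (Ici 0) x y z) (hN : 1 ≤ N) (hc : 0 < c) (hx : 0 < x 0) (hy : 0 < y 0)
    (hz : 0 < z 0) (hyx : y 0 ≤ x 0) :
    ∃ X Y : ℝ, Tendsto x atTop (𝓝 X) ∧ Tendsto y atTop (𝓝 Y) ∧ Tendsto z atTop (𝓝 0) ∧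
      0 < Y ∧ Y ≤ X ∧ X ^ (k + 2) + (N - 1) * Y ^ (k + 2) = N * c ∧
      (k = 0 → X * y 0 = x 0 * Y) ∧ (X ^ k)⁻¹ - (Y ^ k)⁻¹ = (x 0 ^ k)⁻¹ - (y 0 ^ k)⁻¹ := by
  have hT : ∀ T, ReducedFlow k N c (Icc 0 T) x y z := fun T => h.mono Icc_subset_Ici_self
  have hxp : ∀ t, 0 ≤ t → 0 < x t := fun t ht => (hT t).x_pos ht hx
  have hyp : ∀ t, 0 ≤ t → 0 < y t := fun t ht => (hT t).y_pos ht hy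
  have hzp : ∀ t, 0 ≤ t → 0 < z t := fun t ht => ((hT t).z_pos_le ht hz).1
  have hle : ∀ t, 0 ≤ t → y t ≤ x t := fun t ht => (hT t).y_le_x ht hyx
  have hxB : ∀ t, 0 ≤ t → x t ≤ 1 + N * (|residual k N c (x 0) (y 0)| + |c|) :=
    fun t ht => (hT t).x_le ht hN hx hy
  obtain ⟨Z, hZ⟩ := exists_tendsto_of_deriv_nonpos h.z'
    (fun t ht => by have := hzp t ht; rw [neg_nonpos]; positivity) (fun t ht => (hzp t ht).le)
  have hZ0 : Z = 0 := by
    have := eq_zero_of_tendsto_of_tendsto_deriv h.z' hZ (hZ.pow (2 * k + 3)).neg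
    simpa using this
  subst hZ0
  have hlim : ∃ X Y : ℝ, Tendsto x atTop (𝓝 X) ∧ Tendsto y atTop (𝓝 Y) ∧
      (residual k N c (x 0) (y 0) ≤ 0 → x 0 ≤ X) := by
    rcases le_or_gt (residual k N c (x 0) (y 0)) 0 with hr | hr
    · have hr' : ∀ t, 0 ≤ t → residual k N c (x t) (y t) ≤ 0 := fun t ht => by
        obtain ⟨e, he, -, hre⟩ := (hT t).residual_factor ht hN
        rw [hre]
        exact mul_nonpos_of_nonpos_of_nonneg hr he.le
      obtain ⟨X, h0X, hX⟩ := exists_tendsto_of_deriv_nonneg h.x'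
        (fun t ht => neg_nonneg.2 (mul_nonpos_of_nonneg_of_nonpos
          (pow_nonneg (hxp t ht).le _) (hr' t ht))) hxB
      obtain ⟨Y, -, hY⟩ := exists_tendsto_of_deriv_nonneg h.y'
        (fun t ht => neg_nonneg.2 (mul_nonpos_of_nonneg_of_nonpos
          (pow_nonneg (hyp t ht).le _) (hr' t ht))) (fun t ht => (hle t ht).trans (hxB t ht))
      exact ⟨X, Y, hX, hY, fun _ => h0X⟩
    · have hr' : ∀ t, 0 ≤ t → 0 ≤ residual k N c (x t) (y t) := fun t ht => by
        obtain ⟨e, he, -, hre⟩ := (hT t).residual_factor ht hN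
        rw [hre]
        positivity
      obtain ⟨X, hX⟩ := exists_tendsto_of_deriv_nonpos h.x'
        (fun t ht => neg_nonpos.2 (mul_nonneg (pow_nonneg (hxp t ht).le _) (hr' t ht)))
        (fun t ht => (hxp t ht).le)
      obtain ⟨Y, hY⟩ := exists_tendsto_of_deriv_nonpos h.y'
        (fun t ht => neg_nonpos.2 (mul_nonneg (pow_nonneg (hyp t ht).le _) (hr' t ht)))
        (fun t ht => (hyp t ht).le)
      exact ⟨X, Y, hX, hY, fun h' => absurd h' hr.not_ge⟩
  obtain ⟨X, Y, hX, hY, hX0⟩ := hlim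
  have hge := eventually_ge_atTop (0 : ℝ)
  have hY0 : 0 ≤ Y := ge_of_tendsto hY (hge.mono fun t ht => (hyp t ht).le)
  have hYX : Y ≤ X := le_of_tendsto_of_tendsto hY hX (hge.mono hle)
  have hres : Tendsto (fun t => residual k N c (x t) (y t)) atTop (𝓝 (residual k N c X Y)) :=
    (((hX.pow _).add ((hY.pow _).const_mul _)).div_const _).sub_const _
  have hXr : X ^ (k + 1) * residual k N c X Y = 0 := by
    have := eq_zero_of_tendsto_of_tendsto_deriv h.x' hX ((hX.pow (k + 1)).mul hres).neg
    simpa using this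
  have hXpos : 0 < X := by
    -- At the origin the residual is -c < 0. A nonpositive initial residual makes x nondecreasing,
    -- so X ≥ x(0) > 0; a positive one stays positive, so its limit cannot be negative.
    refine (hY0.trans hYX).lt_of_ne' fun hXz => ?_
    have hYz : Y = 0 := le_antisymm (hXz ▸ hYX) hY0
    have hneg : residual k N c X Y < 0 := by simp [residual, hXz, hYz, hc]
    rcases le_or_gt (residual k N c (x 0) (y 0)) 0 with hr | hr
    · exact absurd (hX0 hr) (by rw [hXz]; exact hx.not_ge)
    · refine hneg.not_ge (ge_of_tendsto hres (hge.mono fun t ht => ?_))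
      obtain ⟨e, he, -, hre⟩ := (hT t).residual_factor ht hN
      rw [hre]
      positivity
  have hR : residual k N c X Y = 0 := (mul_eq_zero.1 hXr).resolve_left (by positivity)
  have hratio : k = 0 → X * y 0 = x 0 * Y := by
    rintro rfl
    exact tendsto_nhds_unique (hX.mul_const _) ((hY.const_mul _).congr'
      (hge.mono fun t ht => ((hT t).ratio_eq ht).symm))
  have hYpos : 0 < Y := by
    refine hY0.lt_of_ne' fun hYz => ?_
    rcases Nat.eq_zero_or_pos k with hk | hk
    · have := hratio hk
      rw [hYz, mul_zero] at this
      exact absurd this (by positivity)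
    -- Clearing denominators in the conservation law lets it pass to the limit even if Y = 0, where
    -- it would give X^k = 0.
    · have hmul : Y ^ k - X ^ k = ((x 0 ^ k)⁻¹ - (y 0 ^ k)⁻¹) * (X ^ k * Y ^ k) := by
        refine tendsto_nhds_unique ((hY.pow k).sub (hX.pow k))
          ((((hX.pow k).mul (hY.pow k)).const_mul _).congr' (hge.mono fun t ht => ?_))
        have h1 := hxp t ht
        have h2 := hyp t ht
        rw [← (hT t).inv_pow_sub_inv_pow_eq ht hx hy]
        field_simp
      rw [hYz, zero_pow hk.ne'] at hmul
      have : 0 < X ^ k := by positivity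
      linarith
  refine ⟨X, Y, hX, hY, hZ, hYpos, hYX, ?_, hratio, ?_⟩
  · rw [residual, sub_eq_zero, div_eq_iff (by linarith)] at hR
    linarith
  · refine tendsto_nhds_unique (((hX.pow k).inv₀ (by positivity)).sub
      ((hY.pow k).inv₀ (by positivity))) (tendsto_const_nhds.congr' (hge.mono fun t ht => ?_))
    exact ((hT t).inv_pow_sub_inv_pow_eq ht hx hy).symm

/-- The a priori bounds on x, y and z hold on every interval of existence, which rules out blow-up.
-/
theorem exists_reducedFlow (k : ℕ) {N : ℝ} (c : ℝ) (hN : 1 ≤ N) {x₀ y₀ z₀ : ℝ} (hx : 0 < x₀)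
    (hy : 0 < y₀) (hz : 0 < z₀) (hyx : y₀ ≤ x₀) :
    ∃ x y z : ℝ → ℝ, ReducedFlow k N c (Ici 0) x y z ∧ x 0 = x₀ ∧ y 0 = y₀ ∧ z 0 = z₀ := by
  set v : ℝ × ℝ × ℝ → ℝ × ℝ × ℝ := fun p =>
    (-(p.1 ^ (k + 1) * residual k N c p.1 p.2.1), -(p.2.1 ^ (k + 1) * residual k N c p.1 p.2.1),
      -(p.2.2 ^ (2 * k + 3)))
  have hv : ContDiff ℝ 1 v := by
    unfold v residual
    fun_prop
  have key : ∀ {S : Set ℝ} {f : ℝ → ℝ × ℝ × ℝ},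
      (∀ t ∈ S, HasDerivWithinAt f (v (f t)) S t) →
      ReducedFlow k N c S (fun t => (f t).1) (fun t => (f t).2.1) (fun t => (f t).2.2) := by
    intro S f hf
    exact ⟨fun t ht => (hf t ht).fst, fun t ht => (hf t ht).snd.fst, fun t ht => (hf t ht).snd.snd⟩
  obtain ⟨f, hf0, hf⟩ := exists_hasDerivWithinAt_Ici_of_bounded hv (x₀, y₀, z₀)
    (max (1 + N * (|residual k N c x₀ y₀| + |c|)) z₀) (by
      intro T hT f hf0 hf
      have h := key hf
      have h1 := h.x_pos hT (by simpa [hf0] using hx)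
      have h2 := h.y_pos hT (by simpa [hf0] using hy)
      have h3 := h.z_pos_le hT (by simpa [hf0] using hz)
      have h4 := h.y_le_x hT (by simpa [hf0] using hyx)
      have h5 := h.x_le hT hN (by simpa [hf0] using hx) (by simpa [hf0] using hy)
      simp only [hf0] at h3 h5
      simp only [Prod.norm_def, Real.norm_eq_abs, abs_of_pos h1, abs_of_pos h2, abs_of_pos h3.1]
      exact max_le (h5.trans (le_max_left _ _)) (max_le ((h4.trans h5).trans (le_max_left _ _))
        (h3.2.trans (le_max_right _ _))))
  exact ⟨_, _, _, key hf, by simp [hf0], by simp [hf0], by simp [hf0]⟩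

end Reduced

/-! ### Matrices constant on blocks -/

section Spec

open Matrix

variable {d s n : ℕ}

theorem mem_blockObs_iff (hs : 1 ≤ s) (hd : d = s * n) (p : Fin d × Fin d) :
    p ∈ blockObs d s n ↔ (p.1 : ℕ) / s = (p.2 : ℕ) / s := by
  simp only [blockObs, Finset.mem_filter, Finset.mem_univ, true_and]
  have key : ∀ (a b : ℕ), b * s ≤ a ∧ a < (b + 1) * s ↔ a / s = b := fun a b => by
    rw [Nat.div_eq_iff (by omega)]
    rw [add_mul, one_mul]
    omega
  simp only [key]
  constructor
  · rintro ⟨b, h1, h2⟩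
    rw [h1, h2]
  · intro h
    refine ⟨⟨(p.1 : ℕ) / s, ?_⟩, rfl, h.symm⟩
    rw [Nat.div_lt_iff_lt_mul (by omega), mul_comm n s, ← hd]
    exact p.1.2

theorem card_block (hs : 1 ≤ s) (hd : d = s * n) (i : Fin d) :
    (Finset.univ.filter fun k : Fin d => (k : ℕ) / s = (i : ℕ) / s).card = s := by
  have hi : (i : ℕ) / s < n := by
    rw [Nat.div_lt_iff_lt_mul (by omega), mul_comm n s, ← hd]
    exact i.2
  have hmap : (Finset.univ.filter fun k : Fin d => (k : ℕ) / s = (i : ℕ) / s).map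
      Fin.valEmbedding = Finset.Ico ((i : ℕ) / s * s) ((i : ℕ) / s * s + s) := by
    ext a
    simp only [Finset.mem_map, Finset.mem_filter, Finset.mem_univ, true_and,
      Fin.valEmbedding_apply, Finset.mem_Ico]
    constructor
    · rintro ⟨k, hk, rfl⟩
      rw [Nat.div_eq_iff (by omega)] at hk
      omega
    · rintro ⟨h1, h2⟩
      have had : a < d := by
        calc a < (i : ℕ) / s * s + s := h2
          _ = ((i : ℕ) / s + 1) * s := by ring
          _ ≤ n * s := Nat.mul_le_mul_right s hi
          _ = d := by rw [hd, mul_comm]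
      refine ⟨⟨a, had⟩, ?_, rfl⟩
      change a / s = (i : ℕ) / s
      rw [Nat.div_eq_iff (by omega)]
      omega
  rw [← Finset.card_map Fin.valEmbedding, hmap, Nat.card_Ico]
  omega

/-- The orthogonal projection onto the constant vectors. -/
def meanProj (d : ℕ) : Matrix (Fin d) (Fin d) ℝ := of fun _ _ => (1 / d : ℝ)

/-- The orthogonal projection onto the vectors that are constant on each block of length `s`. -/
def blockProj (d s : ℕ) : Matrix (Fin d) (Fin d) ℝ :=
  of fun i j => if (i : ℕ) / s = (j : ℕ) / s then (1 / s : ℝ) else 0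

/-- The symmetric matrix with eigenvalue `x` on constant vectors, `y` on block-constant vectors of
mean zero and `z` on the vectors whose mean over each block is zero. -/
def spec (d s : ℕ) (x y z : ℝ) : Matrix (Fin d) (Fin d) ℝ :=
  x • meanProj d + y • (blockProj d s - meanProj d) + z • (1 - blockProj d s)

theorem spec_apply (x y z : ℝ) (i j : Fin d) :
    spec d s x y z i j = x * meanProj d i j + y * (blockProj d s i j - meanProj d i j) +
      z * ((1 : Matrix (Fin d) (Fin d) ℝ) i j - blockProj d s i j) := by
  simp [spec]

theorem meanProj_transpose : (meanProj d)ᵀ = meanProj d := rfl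

theorem blockProj_transpose : (blockProj d s)ᵀ = blockProj d s := by
  ext i j
  simp only [blockProj, transpose_apply, of_apply]
  exact if_congr eq_comm rfl rfl

theorem spec_transpose (x y z : ℝ) : (spec d s x y z)ᵀ = spec d s x y z := by
  simp [spec, transpose_add, transpose_smul, transpose_sub, meanProj_transpose,
    blockProj_transpose]

theorem meanProj_mul_self (hd0 : d ≠ 0) : meanProj d * meanProj d = meanProj d := by
  have : (d : ℝ) ≠ 0 := by exact_mod_cast hd0
  ext i j
  simp only [mul_apply, meanProj, of_apply, Finset.sum_const, Finset.card_univ, Fintype.card_fin,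
    nsmul_eq_mul]
  field_simp

theorem blockProj_row_sum (hs : 1 ≤ s) (hd : d = s * n) (i : Fin d) :
    ∑ k, blockProj d s i k = 1 := by
  have h0 : (s : ℝ) ≠ 0 := by positivity
  have h := card_block hs hd i
  simp only [blockProj, of_apply, eq_comm (a := (i : ℕ) / s)]
  rw [← Finset.sum_filter, Finset.sum_const, h, nsmul_eq_mul]
  field_simp

theorem blockProj_mul_meanProj (hs : 1 ≤ s) (hd : d = s * n) :
    blockProj d s * meanProj d = meanProj d := by
  ext i j
  simp only [mul_apply, meanProj, of_apply]
  rw [← Finset.sum_mul, blockProj_row_sum hs hd, one_mul]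

theorem meanProj_mul_blockProj (hs : 1 ≤ s) (hd : d = s * n) :
    meanProj d * blockProj d s = meanProj d := by
  have := congrArg transpose (blockProj_mul_meanProj hs hd)
  rwa [transpose_mul, meanProj_transpose, blockProj_transpose] at this

theorem blockProj_mul_self (hs : 1 ≤ s) (hd : d = s * n) :
    blockProj d s * blockProj d s = blockProj d s := by
  ext i j
  rw [mul_apply]
  have : ∀ k, blockProj d s i k * blockProj d s k j = blockProj d s i k * blockProj d s i j := by
    intro k
    by_cases h : (i : ℕ) / s = (k : ℕ) / s <;> simp [blockProj, h]
  rw [Finset.sum_congr rfl fun k _ => this k, ← Finset.sum_mul, blockProj_row_sum hs hd, one_mul]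

theorem spec_mul (hs : 1 ≤ s) (hd : d = s * n) (hd0 : d ≠ 0) (x y z x' y' z' : ℝ) :
    spec d s x y z * spec d s x' y' z' = spec d s (x * x') (y * y') (z * z') := by
  simp only [spec, add_mul, mul_add, smul_mul_assoc, mul_smul_comm, sub_mul, mul_sub, one_mul,
    mul_one, meanProj_mul_self hd0, blockProj_mul_meanProj hs hd, meanProj_mul_blockProj hs hd,
    blockProj_mul_self hs hd]
  module

theorem spec_one : spec d s 1 1 1 = 1 := by
  simp [spec]

theorem spec_pow (hs : 1 ≤ s) (hd : d = s * n) (hd0 : d ≠ 0) (x y z : ℝ) (k : ℕ) :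
    spec d s x y z ^ k = spec d s (x ^ k) (y ^ k) (z ^ k) := by
  induction k with
  | zero => simp [spec_one]
  | succ k ih => rw [pow_succ, ih, spec_mul hs hd hd0]; simp only [pow_succ]

theorem trace_meanProj (hd0 : d ≠ 0) : (meanProj d).trace = 1 := by
  have : (d : ℝ) ≠ 0 := by exact_mod_cast hd0
  simp [trace, meanProj, this]

theorem trace_blockProj (hs : 1 ≤ s) (hd : d = s * n) : (blockProj d s).trace = n := by
  have h0 : (s : ℝ) ≠ 0 := by positivity
  simp only [trace, blockProj, diag_apply, of_apply, if_true, Finset.sum_const, Finset.card_univ,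
    Fintype.card_fin, nsmul_eq_mul]
  rw [hd]
  push_cast
  field_simp

theorem trace_spec (hs : 1 ≤ s) (hd : d = s * n) (hd0 : d ≠ 0) (x y : ℝ) :
    (spec d s x y 0).trace = x + (n - 1) * y := by
  simp only [spec, trace_add, trace_smul, trace_sub, trace_meanProj hd0, trace_blockProj hs hd,
    smul_eq_mul]
  ring

theorem tendsto_spec {x y z : ℝ → ℝ} {X Y Z : ℝ} (hx : Tendsto x atTop (𝓝 X))
    (hy : Tendsto y atTop (𝓝 Y)) (hz : Tendsto z atTop (𝓝 Z)) :
    Tendsto (fun t => spec d s (x t) (y t) (z t)) atTop (𝓝 (spec d s X Y Z)) := by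
  refine tendsto_pi_nhds.2 fun i => tendsto_pi_nhds.2 fun j => ?_
  simp only [spec_apply]
  exact ((hx.mul_const _).add (hy.mul_const _)).add (hz.mul_const _)

/-- The initial factor has eigenvalues `α (m + d - 1) / m` and `α (m - 1) / m` for finite `m`. -/
theorem initFactor_coe (hd0 : d ≠ 0) (α : ℝ) {μ : ℝ} (hμ : μ ≠ 0) :
    initFactor d α (μ : WithTop ℝ) =
      spec d s (α / μ * (μ + d - 1)) (α / μ * (μ - 1)) (α / μ * (μ - 1)) := by
  have : (d : ℝ) ≠ 0 := by exact_mod_cast hd0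
  ext i j
  rw [spec_apply]
  change (if i = j then α else α / μ) = _
  simp only [meanProj, of_apply, one_apply]
  split_ifs <;> field_simp <;> ring

theorem initFactor_top (α : ℝ) : initFactor d α ⊤ = spec d s α α α := by
  change α • (1 : Matrix (Fin d) (Fin d) ℝ) = _
  rw [spec]
  module

/-- The residual of the observed entries is again block-constant in the sense of `spec`. -/
theorem masked_spec (hs : 1 ≤ s) (hd : d = s * n) (hd0 : d ≠ 0) {wstar : ℝ}
    {Wstar : Matrix (Fin d) (Fin d) ℝ} (hW : ∀ p ∈ blockObs d s n, Wstar p.1 p.2 = wstar)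
    (x y z : ℝ) :
    (of fun i j => if (i, j) ∈ blockObs d s n then spec d s x y z i j - Wstar i j else 0) =
      spec d s ((x + (n - 1) * y) / n - s * wstar) ((x + (n - 1) * y) / n - s * wstar) z := by
  have hs0 : (s : ℝ) ≠ 0 := by positivity
  have hn0 : (n : ℝ) ≠ 0 := by
    rintro h
    exact hd0 (by rw [hd, Nat.cast_eq_zero.1 h, mul_zero])
  have hdR : (d : ℝ) = s * n := by exact_mod_cast hd
  ext i j
  simp only [of_apply, spec_apply]
  by_cases h : (i : ℕ) / s = (j : ℕ) / s
  · have hm : (i, j) ∈ blockObs d s n := (mem_blockObs_iff hs hd _).2 h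
    rw [if_pos hm, hW _ hm]
    -- Since 1/d = (1/n)(1/s), masking turns `meanProj` into `blockProj` divided by n, while the
    -- masked target is s w* times `blockProj`.
    simp only [meanProj, blockProj, of_apply, if_pos h, hdR]
    field_simp
    ring
  · have hm : (i, j) ∉ blockObs d s n := fun h' => h ((mem_blockObs_iff hs hd _).1 h')
    have hij : i ≠ j := fun h' => h (by rw [h'])
    rw [if_neg hm]
    simp only [meanProj, blockProj, of_apply, if_neg h, one_apply_ne hij]
    ring

/-- The loss of a limit point with the right top eigenvalues vanishes. -/
theorem loss_spec_eq_zero (hs : 1 ≤ s) (hd : d = s * n) (hd0 : d ≠ 0) {wstar : ℝ}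
    {Wstar : Matrix (Fin d) (Fin d) ℝ} (hW : ∀ p ∈ blockObs d s n, Wstar p.1 p.2 = wstar)
    {x y : ℝ} (hxy : x + (n - 1) * y = n * (s * wstar)) :
    loss (blockObs d s n) Wstar (spec d s x y 0) = 0 := by
  have hn0 : (n : ℝ) ≠ 0 := by
    rintro h
    exact hd0 (by rw [hd, Nat.cast_eq_zero.1 h, mul_zero])
  have hmask := masked_spec hs hd hd0 hW x y 0
  have hz : (x + (n - 1) * y) / n - s * wstar = 0 := by
    rw [hxy]
    field_simp
    ring
  rw [hz] at hmask
  rw [loss, Finset.sum_eq_zero, mul_zero]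
  rintro ⟨i, j⟩ hp
  have := congrFun (congrFun hmask i) j
  rw [of_apply, if_pos hp] at this
  rw [this]
  simp [spec_apply]

end Spec

/-! ### The gradient of the training objective -/

section Gradient

open Matrix

variable {d L : ℕ}

theorem endToEnd_succ (W : Fin (L + 1) → Matrix (Fin d) (Fin d) ℝ) :
    endToEnd W = endToEnd (fun l => W l.succ) * W 0 := by
  simp [endToEnd, List.ofFn_succ]

theorem endToEnd_const (A : Matrix (Fin d) (Fin d) ℝ) :
    endToEnd (fun _ : Fin L => A) = A ^ L := by
  simp [endToEnd]

theorem endToEnd_update_const (A M : Matrix (Fin d) (Fin d) ℝ) (l : Fin L) :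
    endToEnd (Function.update (fun _ : Fin L => A) l M) =
      A ^ (L - 1 - (l : ℕ)) * M * A ^ (l : ℕ) := by
  induction L with
  | zero => exact l.elim0
  | succ L ih =>
    rw [endToEnd_succ]
    rcases Fin.eq_zero_or_eq_succ l with rfl | ⟨l, rfl⟩
    · simp [Fin.succ_ne_zero, endToEnd_const]
    · have hu : (fun i : Fin L => Function.update (fun _ : Fin (L + 1) => A) l.succ M i.succ) =
          Function.update (fun _ : Fin L => A) l M := by
        ext1 i
        simp [Function.update_apply]
      rw [hu, ih, Function.update_of_ne (Fin.succ_ne_zero l).symm, Fin.val_succ, pow_succ,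
        mul_assoc _ (A ^ _) A, show L + 1 - 1 - ((l : ℕ) + 1) = L - 1 - (l : ℕ) by omega]

/-- The gradient at a point where all factors are equal. -/
theorem objectiveGrad_const (Ω : Finset (Fin d × Fin d)) (Wstar A : Matrix (Fin d) (Fin d) ℝ)
    (l : Fin L) :
    objectiveGrad Ω Wstar (fun _ : Fin L => A) l =
      (A ^ (L - 1 - (l : ℕ)))ᵀ * (of fun i j => if (i, j) ∈ Ω then (A ^ L) i j - Wstar i j else 0)
        * (A ^ (l : ℕ))ᵀ := by
  ext i j
  set P := A ^ (L - 1 - (l : ℕ))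
  set Q := A ^ (l : ℕ)
  have hPQ : P * A * Q = A ^ L := by
    have hl := l.2
    rw [← pow_succ, ← pow_add]
    congr 1
    omega
  have hfun : (fun x : ℝ => objective Ω Wstar (Function.update (fun _ : Fin L => A) l
      (A + x • single i j (1 : ℝ)))) =
      fun x : ℝ => (1 / 2) * ∑ p ∈ Ω,
        ((A ^ L) p.1 p.2 + x * (P p.1 i * Q j p.2) - Wstar p.1 p.2) ^ 2 := by
    ext x
    have hentry : ∀ p q, (P * single i j (1 : ℝ) * Q) p q = P p i * Q j q := by
      intro p q
      rw [mul_apply, Finset.sum_eq_single j]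
      · simp
      · intro b _ hb
        rw [mul_single_apply_of_ne _ _ _ _ _ hb, zero_mul]
      · simp
    simp only [objective, loss, endToEnd_update_const]
    rw [mul_add, add_mul, hPQ, mul_smul_comm, smul_mul_assoc]
    simp only [Matrix.add_apply, Matrix.smul_apply, smul_eq_mul]
    refine congrArg _ (Finset.sum_congr rfl fun p _ => ?_)
    rw [← hentry]
  -- Perturbing one entry of one factor changes the product affinely, so the objective is a
  -- quadratic polynomial in `x`.
  have hder : HasDerivAt (fun x : ℝ => (1 / 2) * ∑ p ∈ Ω,
      ((A ^ L) p.1 p.2 + x * (P p.1 i * Q j p.2) - Wstar p.1 p.2) ^ 2)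
      (∑ p ∈ Ω, ((A ^ L) p.1 p.2 - Wstar p.1 p.2) * (P p.1 i * Q j p.2)) 0 := by
    have : ∀ p ∈ Ω, HasDerivAt
        (fun x : ℝ => ((A ^ L) p.1 p.2 + x * (P p.1 i * Q j p.2) - Wstar p.1 p.2) ^ 2)
        (2 * (((A ^ L) p.1 p.2 - Wstar p.1 p.2) * (P p.1 i * Q j p.2))) 0 := by
      intro p _
      have h1 := ((((hasDerivAt_id (0 : ℝ)).mul_const (P p.1 i * Q j p.2)).const_add
        ((A ^ L) p.1 p.2)).sub_const (Wstar p.1 p.2)).pow 2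
      convert! h1 using 1
      simp
      ring
    convert! (HasDerivAt.fun_sum this).const_mul (1 / 2 : ℝ) using 1
    rw [← Finset.mul_sum]
    ring
  rw [objectiveGrad, of_apply, hfun, hder.deriv, mul_apply]
  simp only [mul_apply, transpose_apply, of_apply, Finset.sum_mul]
  rw [Finset.sum_comm, ← Finset.sum_product', Finset.univ_product_univ,
    ← Finset.sum_filter_add_sum_filter_not Finset.univ (fun p => p ∈ Ω)]
  rw [Finset.sum_eq_zero (s := Finset.univ.filter fun p => p ∉ Ω), add_zero]
  · rw [Finset.filter_univ_mem]
    refine Finset.sum_congr rfl fun p hp => ?_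
    rw [if_pos hp]
    ring
  · intro p hp
    rw [if_neg (Finset.mem_filter.1 hp).2]
    ring

/-- The objective as a function of the entries of the factors. -/
def entryObjective (Ω : Finset (Fin d × Fin d)) (Wstar : Matrix (Fin d) (Fin d) ℝ)
    (W : Fin L → Fin d → Fin d → ℝ) : ℝ :=
  objective Ω Wstar fun l => of (W l)

/-- Order 2 is what makes the gradient field C¹, as the uniqueness argument requires. -/
theorem contDiff_endToEnd_apply (L : ℕ) (i j : Fin d) :
    ContDiff ℝ 2 fun W : Fin L → Fin d → Fin d → ℝ => endToEnd (fun l => of (W l)) i j := by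
  induction L generalizing i j with
  | zero => simpa [endToEnd] using contDiff_const
  | succ L ih =>
    simp only [endToEnd_succ, mul_apply, of_apply]
    refine ContDiff.sum fun k _ => ContDiff.mul ?_ ?_
    · exact (ih i k).comp (contDiff_pi.2 fun l => contDiff_apply ℝ _ l.succ)
    · fun_prop

theorem contDiff_entryObjective (Ω : Finset (Fin d × Fin d)) (Wstar : Matrix (Fin d) (Fin d) ℝ) :
    ContDiff ℝ 2 (entryObjective (L := L) Ω Wstar) := by
  unfold entryObjective objective loss
  exact contDiff_const.mul (ContDiff.sum fun p _ =>
    ((contDiff_endToEnd_apply L p.1 p.2).sub contDiff_const).pow 2)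

/-- The negative gradient as a vector field on the space of entries. -/
def gradField (Ω : Finset (Fin d × Fin d)) (Wstar : Matrix (Fin d) (Fin d) ℝ)
    (W : Fin L → Fin d → Fin d → ℝ) : Fin L → Fin d → Fin d → ℝ :=
  fun l i j => -(objectiveGrad Ω Wstar (fun l => of (W l)) l i j)

theorem objectiveGrad_eq_fderiv (Ω : Finset (Fin d × Fin d)) (Wstar : Matrix (Fin d) (Fin d) ℝ)
    (W : Fin L → Fin d → Fin d → ℝ) (l : Fin L) (i j : Fin d) :
    objectiveGrad Ω Wstar (fun l => of (W l)) l i j =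
      fderiv ℝ (entryObjective Ω Wstar) W (Pi.single l (Pi.single i (Pi.single j 1))) := by
  have hdiff : DifferentiableAt ℝ (entryObjective Ω Wstar) W :=
    (contDiff_entryObjective Ω Wstar).differentiable (by norm_num) W
  rw [← hdiff.lineDeriv_eq_fderiv, lineDeriv, objectiveGrad, of_apply]
  congr 1
  ext x
  unfold entryObjective
  congr 1
  ext l' i' j'
  by_cases hl : l' = l
  · subst hl
    by_cases hi : i' = i
    · subst hi
      by_cases hj : j' = j
      · subst hj
        simp
      · simp [hj, Ne.symm hj]
    · simp [hi, Ne.symm hi]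
  · simp [hl]

theorem contDiff_gradField (Ω : Finset (Fin d × Fin d)) (Wstar : Matrix (Fin d) (Fin d) ℝ) :
    ContDiff ℝ 1 (gradField (L := L) Ω Wstar) := by
  refine contDiff_pi.2 fun l => contDiff_pi.2 fun i => contDiff_pi.2 fun j => ?_
  simp only [gradField, objectiveGrad_eq_fderiv]
  exact (((contDiff_entryObjective Ω Wstar).fderiv_right (m := 1) (by norm_num)).clm_apply
    contDiff_const).neg

/-- Gradient flows with the same initial factors agree for all nonnegative times. -/
theorem IsGradientFlow.eq_of_eq_zero {Ω : Finset (Fin d × Fin d)}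
    {Wstar : Matrix (Fin d) (Fin d) ℝ} {W W' : ℝ → Fin L → Matrix (Fin d) (Fin d) ℝ}
    (hW : IsGradientFlow Ω Wstar W) (hW' : IsGradientFlow Ω Wstar W') (h0 : W 0 = W' 0) {t : ℝ}
    (ht : 0 ≤ t) : W t = W' t := by
  have key : ∀ {V : ℝ → Fin L → Matrix (Fin d) (Fin d) ℝ}, IsGradientFlow Ω Wstar V →
      ∀ τ ∈ Set.Icc 0 t, HasDerivWithinAt (fun τ => (fun l i j => V τ l i j :
        Fin L → Fin d → Fin d → ℝ)) (gradField Ω Wstar (fun l i j => V τ l i j))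
        (Set.Icc 0 t) τ := by
    intro V hV τ hτ
    refine hasDerivWithinAt_pi.2 fun l => hasDerivWithinAt_pi.2 fun i =>
      hasDerivWithinAt_pi.2 fun j => ?_
    exact (hV τ hτ.1 l i j).mono Set.Icc_subset_Ici_self
  have := eqOn_of_hasDerivWithinAt_Icc (contDiff_gradField Ω Wstar) (key hW) (key hW')
    (by rw [h0]) ⟨ht, le_rfl⟩
  ext l i j
  exact congrFun (congrFun (congrFun this l) i) j

variable {s n : ℕ}

/-- The factors on the two sides of the masked error commute with it, so only the total exponent k +
1 matters and the layer index drops out. On the third eigenspace the error is z^(k+2), whence the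
exponent 2k + 3. -/
theorem objectiveGrad_spec (hs : 1 ≤ s) (hd : d = s * n) (hd0 : d ≠ 0) {wstar : ℝ}
    {Wstar : Matrix (Fin d) (Fin d) ℝ} (hW : ∀ p ∈ blockObs d s n, Wstar p.1 p.2 = wstar)
    (k : ℕ) (x y z : ℝ) (l : Fin (k + 2)) :
    objectiveGrad (blockObs d s n) Wstar (fun _ : Fin (k + 2) => spec d s x y z) l =
      spec d s (x ^ (k + 1) * residual k n (s * wstar) x y)
        (y ^ (k + 1) * residual k n (s * wstar) x y) (z ^ (2 * k + 3)) := by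
  rw [objectiveGrad_const]
  simp only [spec_pow hs hd hd0, spec_transpose]
  rw [masked_spec hs hd hd0 hW, spec_mul hs hd hd0, spec_mul hs hd hd0]
  have hl : k + 1 = (k + 2 - 1 - (l : ℕ)) + l := by
    have := l.2
    omega
  have h2 : 2 * k + 3 = (k + 2 - 1 - (l : ℕ)) + (k + 2) + l := by omega
  rw [h2, hl]
  simp only [pow_add, residual]
  congr 1 <;> ring

/-- A solution of the reduced flow of the eigenvalues gives a solution of the gradient flow. -/
theorem ReducedFlow.isGradientFlow (hs : 1 ≤ s) (hd : d = s * n) (hd0 : d ≠ 0) {wstar : ℝ}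
    {Wstar : Matrix (Fin d) (Fin d) ℝ} (hW : ∀ p ∈ blockObs d s n, Wstar p.1 p.2 = wstar)
    {k : ℕ} {x y z : ℝ → ℝ} (h : ReducedFlow k n (s * wstar) (Set.Ici 0) x y z) :
    IsGradientFlow (blockObs d s n) Wstar
      (fun t (_ : Fin (k + 2)) => spec d s (x t) (y t) (z t)) := by
  intro t ht l i j
  rw [objectiveGrad_spec hs hd hd0 hW]
  simp only [spec_apply]
  convert! (((h.x' t ht).mul_const (meanProj d i j)).add ((h.y' t ht).mul_const
    (blockProj d s i j - meanProj d i j))).add ((h.z' t ht).mul_const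
    ((1 : Matrix (Fin d) (Fin d) ℝ) i j - blockProj d s i j)) using 1
  ring

end Gradient

/-! ### Singular values of block-constant matrices -/

section SingularValues

open Matrix Module

variable {d s n : ℕ}

theorem trace_toEuclideanLin (A : Matrix (Fin d) (Fin d) ℝ) :
    LinearMap.trace ℝ _ (toEuclideanLin A) = A.trace := by
  exact trace_toLin_eq A (EuclideanSpace.basisFun (Fin d) ℝ).toBasis

/-- For nonzero x and y the range is that of the projection `spec d s 1 1 0`, and the rank of a
projection is its trace. -/
theorem finrank_range_spec (hs : 1 ≤ s) (hd : d = s * n) (hd0 : d ≠ 0) {x y : ℝ} (hx : x ≠ 0)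
    (hy : y ≠ 0) : finrank ℝ (LinearMap.range (toEuclideanLin (spec d s x y 0))) = n := by
  have hmul : ∀ a b a' b' : ℝ, toEuclideanLin (spec d s (a * a') (b * b') 0) =
      toEuclideanLin (spec d s a b 0) ∘ₗ toEuclideanLin (spec d s a' b' 0) := by
    intro a b a' b'
    rw [← toLpLin_mul_same, spec_mul hs hd hd0, mul_zero]
  have hrange : LinearMap.range (toEuclideanLin (spec d s x y 0)) =
      LinearMap.range (toEuclideanLin (spec d s 1 1 0)) := by
    apply le_antisymm
    · have := hmul 1 1 x y
      rw [one_mul, one_mul] at this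
      rw [this]
      exact LinearMap.range_comp_le_range _ _
    · have := hmul x y x⁻¹ y⁻¹
      rw [mul_inv_cancel₀ hx, mul_inv_cancel₀ hy] at this
      rw [this]
      exact LinearMap.range_comp_le_range _ _
  have hidem : IsIdempotentElem (toEuclideanLin (spec d s 1 1 0)) := by
    have := hmul 1 1 1 1
    rw [one_mul] at this
    exact this.symm
  have htr := (LinearMap.IsIdempotentElem.isProj_range _ hidem).trace
  rw [trace_toEuclideanLin, trace_spec hs hd hd0] at htr
  rw [hrange]
  have : ((finrank ℝ (LinearMap.range (toEuclideanLin (spec d s 1 1 0))) : ℕ) : ℝ) = n := by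
    rw [← htr]
    ring
  exact_mod_cast this

theorem adjoint_comp_self_spec (hs : 1 ≤ s) (hd : d = s * n) (hd0 : d ≠ 0) (x y : ℝ) :
    LinearMap.adjoint (toEuclideanLin (spec d s x y 0)) ∘ₗ toEuclideanLin (spec d s x y 0) =
      toEuclideanLin (spec d s (x ^ 2) (y ^ 2) 0) := by
  rw [← toEuclideanLin_conjTranspose_eq_adjoint, conjTranspose_eq_transpose_of_trivial,
    spec_transpose, ← toLpLin_mul_same, spec_mul hs hd hd0, mul_zero, sq, sq]

/-- The operator is annihilated by the polynomial t(t - x)(t - y). -/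
theorem eigenvalue_spec (hs : 1 ≤ s) (hd : d = s * n) (hd0 : d ≠ 0) {x y μ : ℝ}
    (hμ : End.HasEigenvalue (toEuclideanLin (spec d s x y 0)) μ) : μ = 0 ∨ μ = x ∨ μ = y := by
  obtain ⟨v, hv⟩ := hμ.exists_hasEigenvector
  set S := toEuclideanLin (spec d s x y 0)
  have hSv : S v = μ • v := hv.apply_eq_smul
  have hcube : S ∘ₗ (S ∘ₗ S) = (x + y) • (S ∘ₗ S) - (x * y) • S := by
    simp only [S, ← toLpLin_mul_same, spec_mul hs hd hd0, ← map_smul, ← map_sub]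
    congr 1
    simp only [spec]
    module
  have h := LinearMap.congr_fun hcube v
  simp only [LinearMap.comp_apply, LinearMap.sub_apply, LinearMap.smul_apply, hSv, map_smul,
    smul_smul] at h
  have h' : (μ * (μ - x) * (μ - y)) • v = 0 := by
    rw [← sub_eq_zero] at h
    rw [← h]
    module
  rcases mul_eq_zero.1 ((smul_eq_zero.1 h').resolve_right hv.2) with h1 | h1
  · rcases mul_eq_zero.1 h1 with h2 | h2
    · exact Or.inl h2
    · exact Or.inr (Or.inl (sub_eq_zero.1 h2))
  · exact Or.inr (Or.inr (sub_eq_zero.1 h1))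

/-- The singular values of a block-constant matrix with eigenvalues `x ≥ y > 0`. -/
theorem singVal_spec (hs : 1 ≤ s) (hn : 1 ≤ n) (hd : d = s * n) {x y : ℝ} (hy : 0 < y)
    (hyx : y ≤ x) :
    singVal (spec d s x y 0) 0 = x ∧ (∀ k, 1 ≤ k → k < n → singVal (spec d s x y 0) k = y) ∧
      ∀ k, n ≤ k → singVal (spec d s x y 0) k = 0 := by
  have hnd : n ≤ d := by
    rw [hd]
    exact Nat.le_mul_of_pos_left n hs
  have hd0 : d ≠ 0 := by omega
  have hx : 0 < x := hy.trans_le hyx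
  set T := toEuclideanLin (spec d s x y 0)
  set σ : ℕ → ℝ := singVal (spec d s x y 0)
  have hrank : finrank ℝ (LinearMap.range T) = n := finrank_range_spec hs hd hd0 hx.ne' hy.ne'
  have hzero : ∀ k, n ≤ k → σ k = 0 := fun k hk =>
    T.singularValues_eq_zero_iff_le_finrank_range.2 (hrank.trans_le hk)
  have hval : ∀ k, k < n → σ k = x ∨ σ k = y := by
    intro k hk
    have hpos : 0 < σ k := T.singularValues_pos_iff_lt_finrank_range.2 (hk.trans_eq hrank.symm)
    have hev := T.hasEigenvalue_adjoint_comp_self_sq_singularValues (n := k)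
      (by rw [finrank_euclideanSpace_fin]; omega)
    rw [adjoint_comp_self_spec hs hd hd0] at hev
    change End.HasEigenvalue _ (σ k ^ 2) at hev
    rcases eigenvalue_spec hs hd hd0 hev with h | h | h
    · exact absurd h (by positivity)
    · exact Or.inl ((sq_eq_sq₀ hpos.le hx.le).1 h)
    · exact Or.inr ((sq_eq_sq₀ hpos.le hy.le).1 h)
  -- Each nonzero singular value is x or y; the trace of AᵀA then determines the multiplicities.
  have hsum : ∑ k ∈ Finset.range n, σ k ^ 2 = x ^ 2 + (n - 1) * y ^ 2 := by
    have htr := T.isSymmetric_adjoint_comp_self.trace_eq_sum_eigenvalues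
      (finrank_euclideanSpace_fin (n := d))
    have htr' : LinearMap.trace ℝ _ (LinearMap.adjoint T ∘ₗ T) = x ^ 2 + (n - 1) * y ^ 2 := by
      rw [adjoint_comp_self_spec hs hd hd0, trace_toEuclideanLin, trace_spec hs hd hd0]
    rw [← htr', htr, RCLike.ofReal_real_eq_id, id, Finset.sum_subset (Finset.range_subset_range.2 hnd)
      (fun k _ hk => by rw [hzero k (by simpa using hk)]; simp),
      ← Fin.sum_univ_eq_sum_range (fun k => σ k ^ 2) d]
    exact Finset.sum_congr rfl fun i _ => T.sq_singularValues_fin finrank_euclideanSpace_fin i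
  have hanti : Antitone σ := T.singularValues_antitone
  obtain ⟨n', rfl⟩ : ∃ n', n = n' + 1 := ⟨n - 1, by omega⟩
  have hdiff : ∑ k ∈ Finset.range (n' + 1), (σ k ^ 2 - y ^ 2) = x ^ 2 - y ^ 2 := by
    rw [Finset.sum_sub_distrib, hsum, Finset.sum_const, Finset.card_range, nsmul_eq_mul]
    push_cast
    ring
  -- If the largest singular value were y, all n of them would be y, and the trace identity would
  -- force x = y.
  have h0 : σ 0 = x := by
    refine (hval 0 (by omega)).elim id fun h => ?_
    have hall : ∀ k ∈ Finset.range (n' + 1), σ k ^ 2 - y ^ 2 = 0 := by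
      intro k hk
      have hle := hanti (Nat.zero_le k)
      rw [h] at hle
      rcases hval k (Finset.mem_range.1 hk) with h' | h'
      · rw [h', le_antisymm (h' ▸ hle) hyx, sub_self]
      · rw [h', sub_self]
    rw [Finset.sum_eq_zero hall] at hdiff
    rw [h, (sq_eq_sq₀ hy.le hx.le).1 (by linarith)]
  refine ⟨h0, fun k hk hkn => ?_, hzero⟩
  -- With the top term removed, nonnegative terms sum to zero, so each vanishes.
  rw [Finset.sum_range_succ', h0] at hdiff
  have hnonneg : ∀ i ∈ Finset.range n', 0 ≤ σ (i + 1) ^ 2 - y ^ 2 := by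
    intro i hi
    have hi' := Finset.mem_range.1 hi
    rcases hval (i + 1) (by omega) with h | h <;> rw [h]
    · exact sub_nonneg.2 (pow_le_pow_left₀ hy.le hyx 2)
    · rw [sub_self]
  have hk0 := (Finset.sum_eq_zero_iff_of_nonneg hnonneg).1 (by linarith) (k - 1)
    (Finset.mem_range.2 (by omega))
  rw [Nat.sub_add_cancel hk] at hk0
  rcases hval k hkn with h | h
  · rw [h] at hk0 ⊢
    exact (sq_eq_sq₀ hx.le hy.le).1 (by linarith)
  · exact h

end SingularValues

/-! ### Convergence of the gradient flow -/

section Convergence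

variable {d s n : ℕ}

theorem continuous_loss (Ω : Finset (Fin d × Fin d)) (Wstar : Matrix (Fin d) (Fin d) ℝ) :
    Continuous (loss Ω Wstar) := by
  unfold loss
  exact continuous_const.mul (continuous_finsetSum _ fun p _ =>
    ((continuous_id.matrix_elem p.1 p.2).sub continuous_const).pow 2)

theorem exists_isGradientFlow (hs : 1 ≤ s) (hn : 1 ≤ n) (hd : d = s * n) {wstar : ℝ}
    {Wstar : Matrix (Fin d) (Fin d) ℝ} (hW : ∀ p ∈ blockObs d s n, Wstar p.1 p.2 = wstar) (k : ℕ)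
    {x₀ y₀ : ℝ} (hy : 0 < y₀) (hyx : y₀ ≤ x₀) :
    ∃ x y z : ℝ → ℝ, ReducedFlow k n (s * wstar) (Set.Ici 0) x y z ∧
      x 0 = x₀ ∧ y 0 = y₀ ∧ z 0 = y₀ ∧ IsGradientFlow (blockObs d s n) Wstar
        (fun t (_ : Fin (k + 2)) => spec d s (x t) (y t) (z t)) := by
  have hd0 : d ≠ 0 := by
    rw [hd]
    positivity
  obtain ⟨x, y, z, h, hx0, hy0, hz0⟩ := exists_reducedFlow k (N := n) (s * wstar)
    (by exact_mod_cast hn) (hy.trans_le hyx) hy hy hyx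
  exact ⟨x, y, z, h, hx0, hy0, hz0, h.isGradientFlow hs hd hd0 hW⟩

/-- Every gradient flow started at equal factors `spec d s x₀ y₀ y₀` converges, and the limit is
determined by its top eigenvalues `X ^ L` and `Y ^ L`. -/
theorem IsGradientFlow.tendsto_endToEnd (hs : 1 ≤ s) (hn : 1 ≤ n) (hd : d = s * n) {wstar : ℝ}
    (hw : 0 < wstar) {Wstar : Matrix (Fin d) (Fin d) ℝ}
    (hWs : ∀ p ∈ blockObs d s n, Wstar p.1 p.2 = wstar) {k : ℕ} {x₀ y₀ : ℝ} (hy : 0 < y₀)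
    (hyx : y₀ ≤ x₀) {W : ℝ → Fin (k + 2) → Matrix (Fin d) (Fin d) ℝ}
    (hW : IsGradientFlow (blockObs d s n) Wstar W) (h0 : ∀ l, W 0 l = spec d s x₀ y₀ y₀) :
    ∃ X Y : ℝ, 0 < Y ∧ Y ≤ X ∧ X ^ (k + 2) + (n - 1) * Y ^ (k + 2) = wstar * d ∧
      (k = 0 → X * y₀ = x₀ * Y) ∧ (X ^ k)⁻¹ - (Y ^ k)⁻¹ = (x₀ ^ k)⁻¹ - (y₀ ^ k)⁻¹ ∧
      loss (blockObs d s n) Wstar (spec d s (X ^ (k + 2)) (Y ^ (k + 2)) 0) = 0 ∧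
      Tendsto (fun t => endToEnd (W t)) atTop (𝓝 (spec d s (X ^ (k + 2)) (Y ^ (k + 2)) 0)) := by
  have hd0 : d ≠ 0 := by
    rw [hd]
    positivity
  obtain ⟨x, y, z, h, rfl, rfl, hz0, hflow⟩ := exists_isGradientFlow hs hn hd hWs k hy hyx
  obtain ⟨X, Y, hX, hY, hZ, hYpos, hYX, hsum, hratio, hinv⟩ := h.tendsto
    (by exact_mod_cast hn) (by positivity) (hy.trans_le hyx) hy (by rwa [hz0]) hyx
  have hdR : (d : ℝ) = s * n := by exact_mod_cast hd
  have heq : ∀ t, 0 ≤ t → endToEnd (W t) =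
      spec d s (x t ^ (k + 2)) (y t ^ (k + 2)) (z t ^ (k + 2)) := by
    intro t ht
    rw [hW.eq_of_eq_zero hflow (by ext1 l; rw [h0 l, hz0]) ht, endToEnd_const,
      spec_pow hs hd hd0]
  refine ⟨X, Y, hYpos, hYX, ?_, hratio, hinv, loss_spec_eq_zero hs hd hd0 hWs hsum, ?_⟩
  · rw [hsum, hdR]
    ring
  · have hlim := tendsto_spec (d := d) (s := s) (hX.pow (k + 2)) (hY.pow (k + 2)) (hZ.pow (k + 2))
    rw [zero_pow (by omega)] at hlim
    exact hlim.congr' ((eventually_ge_atTop 0).mono fun t ht => (heq t ht).symm)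

/-- With L = k + 2 the exponent L · (2 - L)/L is -k; this carries the conserved quantity over to
singular values. -/
theorem pow_rpow_eq_inv_pow (k : ℕ) {x : ℝ} (hx : 0 < x) :
    (x ^ (k + 2)) ^ ((2 - ((k + 2 : ℕ) : ℝ)) / ((k + 2 : ℕ) : ℝ)) = (x ^ k)⁻¹ := by
  have hk : ((k + 2 : ℕ) : ℝ) ≠ 0 := by positivity
  rw [← Real.rpow_natCast x (k + 2), ← Real.rpow_mul hx.le, mul_div_cancel₀ _ hk,
    show (2 : ℝ) - ((k + 2 : ℕ) : ℝ) = -(k : ℝ) by push_cast; ring, Real.rpow_neg hx.le,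
    Real.rpow_natCast]

theorem couplingConst_eq (α m : ℝ) (k d : ℕ) :
    couplingConst α m (k + 2) d =
      ((α / m * (m + d - 1)) ^ k)⁻¹ - ((α / m * (m - 1)) ^ k)⁻¹ := by
  rw [couplingConst, show (2 : ℤ) - ((k + 2 : ℕ) : ℤ) = -(k : ℤ) by push_cast; ring]
  simp only [zpow_neg, zpow_natCast, mul_pow, mul_inv]
  ring

/-- Every initial factor has the form `spec d s x₀ y₀ y₀` with `x₀ ≥ y₀ > 0`. -/
theorem exists_initFactor_eq_spec (s : ℕ) (hd0 : d ≠ 0) {α : ℝ} (hα : 0 < α) {m : WithTop ℝ}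
    (hm : 1 < m) :
    ∃ x₀ y₀ : ℝ, 0 < y₀ ∧ y₀ ≤ x₀ ∧ initFactor d α m = spec d s x₀ y₀ y₀ ∧
      (∀ μ : ℝ, m = (μ : WithTop ℝ) → 1 < μ ∧ x₀ = α / μ * (μ + d - 1) ∧ y₀ = α / μ * (μ - 1)) ∧
      (m = ⊤ → x₀ = y₀) := by
  induction m using WithTop.recTopCoe with
  | top => exact ⟨α, α, hα, le_rfl, initFactor_top α, fun μ h => absurd h WithTop.top_ne_coe,
      fun _ => rfl⟩
  | coe μ =>
    have hμ : 1 < μ := by exact_mod_cast hm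
    have hμ0 : 0 < μ := one_pos.trans hμ
    have hαμ : 0 < α / μ := by positivity
    refine ⟨_, _, mul_pos hαμ (by linarith), ?_, initFactor_coe hd0 α hμ0.ne', ?_,
      fun h => absurd h WithTop.coe_ne_top⟩
    · have : (0 : ℝ) ≤ d := by positivity
      exact mul_le_mul_of_nonneg_left (by linarith) hαμ.le
    · intro μ' h
      rw [← WithTop.coe_injective h]
      exact ⟨hμ, rfl, rfl⟩

end Convergence

end DeepMatrixFactorization

end

theorem theorem3p3
    (d s n L : ℕ) (hs : 1 ≤ s) (hn : 2 ≤ n) (hd : d = s * n) (hL : 2 ≤ L)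
    (α : ℝ) (hα : 0 < α) (m : WithTop ℝ) (hm : 1 < m)
    (wstar : ℝ) (hw : 0 < wstar)
    (Wstar : Matrix (Fin d) (Fin d) ℝ)
    (hW : ∀ p ∈ DeepMatrixFactorization.blockObs d s n, Wstar p.1 p.2 = wstar) :
    (∃ W : ℝ → Fin L → Matrix (Fin d) (Fin d) ℝ,
      DeepMatrixFactorization.IsGradientFlow (DeepMatrixFactorization.blockObs d s n) Wstar W ∧
      ∀ l, W 0 l = DeepMatrixFactorization.initFactor d α m) ∧
    ∀ W : ℝ → Fin L → Matrix (Fin d) (Fin d) ℝ,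
      DeepMatrixFactorization.IsGradientFlow (DeepMatrixFactorization.blockObs d s n) Wstar W →
      (∀ l, W 0 l = DeepMatrixFactorization.initFactor d α m) →
      Tendsto (fun t => DeepMatrixFactorization.loss (DeepMatrixFactorization.blockObs d s n) Wstar
        (DeepMatrixFactorization.endToEnd (W t))) atTop (𝓝 0) ∧
      ∃ Winf : Matrix (Fin d) (Fin d) ℝ,
        Tendsto (fun t => DeepMatrixFactorization.endToEnd (W t)) atTop (𝓝 Winf) ∧
        DeepMatrixFactorization.loss (DeepMatrixFactorization.blockObs d s n) Wstar Winf = 0 ∧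
        -- singular values are indexed from 0: σ_{k+1} is `singVal Winf k`
        (∀ k, n ≤ k → DeepMatrixFactorization.singVal Winf k = 0) ∧
        -- depth two, finite m
        (∀ μ : ℝ, m = (μ : WithTop ℝ) → L = 2 →
          DeepMatrixFactorization.singVal Winf 0 =
            wstar * d * (μ + d - 1) ^ 2 / ((μ + d - 1) ^ 2 + (n - 1) * (μ - 1) ^ 2) ∧
          ∀ k, 1 ≤ k → k < n →
            DeepMatrixFactorization.singVal Winf k =
              wstar * d * (μ - 1) ^ 2 / ((μ + d - 1) ^ 2 + (n - 1) * (μ - 1) ^ 2)) ∧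
        -- depth at least three, finite m; the bases of the real powers are positive
        (∀ μ : ℝ, m = (μ : WithTop ℝ) → 3 ≤ L →
          (0 < DeepMatrixFactorization.singVal Winf 0 ∧
            DeepMatrixFactorization.singVal Winf 0 < wstar * d ∧
            DeepMatrixFactorization.singVal Winf 0 ^ ((2 - (L : ℝ)) / L)
              - ((wstar * d - DeepMatrixFactorization.singVal Winf 0) / (n - 1))
                  ^ ((2 - (L : ℝ)) / L)
              = DeepMatrixFactorization.couplingConst α μ L d) ∧
          ∀ k, 1 ≤ k → k < n →
            0 < DeepMatrixFactorization.singVal Winf k ∧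
            (n - 1) * DeepMatrixFactorization.singVal Winf k < wstar * d ∧
            (wstar * d - (n - 1) * DeepMatrixFactorization.singVal Winf k) ^ ((2 - (L : ℝ)) / L)
              - DeepMatrixFactorization.singVal Winf k ^ ((2 - (L : ℝ)) / L)
              = DeepMatrixFactorization.couplingConst α μ L d) ∧
        -- scaled identity initialization
        (m = ⊤ → ∀ k, k < n → DeepMatrixFactorization.singVal Winf k = s * wstar) := by
  have hd0 : d ≠ 0 := by
    rw [hd]
    positivity
  obtain ⟨k, rfl⟩ : ∃ k, L = k + 2 := ⟨L - 2, by omega⟩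
  obtain ⟨x₀, y₀, hy, hyx, hinit, hfin, htop⟩ :=
    DeepMatrixFactorization.exists_initFactor_eq_spec (d := d) s hd0 hα hm
  have hn1 : 1 ≤ n := by omega
  refine ⟨?_, fun W hflow h0 => ?_⟩
  · obtain ⟨x, y, z, -, rfl, rfl, hz0, hflow⟩ :=
      DeepMatrixFactorization.exists_isGradientFlow hs hn1 hd hW k hy hyx
    exact ⟨_, hflow, fun _ => by rw [hinit, hz0]⟩
  obtain ⟨X, Y, hY, hYX, hsum, hratio, hinv, hloss, hlim⟩ :=
    hflow.tendsto_endToEnd hs hn1 hd hw hW hy hyx fun l => (h0 l).trans hinit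
  have hX : 0 < X := hY.trans_le hYX
  have hnR : (0 : ℝ) < n - 1 := by
    have : (2 : ℝ) ≤ n := by exact_mod_cast hn
    linarith
  have hXL : 0 < X ^ (k + 2) := by positivity
  have hYL : 0 < Y ^ (k + 2) := by positivity
  have hnY : 0 < (n - 1) * Y ^ (k + 2) := by positivity
  obtain ⟨hσ0, hσ, hσn⟩ := DeepMatrixFactorization.singVal_spec hs hn1 hd hYL
    (pow_le_pow_left₀ hY.le hYX (k + 2))
  refine ⟨?_, _, hlim, hloss, hσn, ?_, ?_, ?_⟩
  · have := ((DeepMatrixFactorization.continuous_loss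
      (DeepMatrixFactorization.blockObs d s n) Wstar).tendsto _).comp hlim
    rwa [hloss] at this
  · intro μ hμ hL
    obtain rfl : k = 0 := by omega
    obtain ⟨hμ1, rfl, rfl⟩ := hfin μ hμ
    have hαμ : 0 < α / μ := div_pos hα (one_pos.trans hμ1)
    -- For L = 2 the conserved ratio X/Y equals the initial one, in which α/μ cancels.
    have hr : X * (μ - 1) = (μ + d - 1) * Y :=
      mul_left_cancel₀ hαμ.ne' (by linear_combination hratio rfl)
    have hden : (0 : ℝ) < (μ + d - 1) ^ 2 + (n - 1) * (μ - 1) ^ 2 := by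
      have : 0 < μ - 1 := by linarith
      positivity
    rw [zero_add] at hsum
    refine ⟨?_, fun j hj hjn => ?_⟩
    · rw [hσ0, eq_div_iff hden.ne']
      linear_combination (μ + d - 1) ^ 2 * hsum +
        (n - 1) * (X * (μ - 1) + (μ + d - 1) * Y) * hr
    · rw [hσ j hj hjn, eq_div_iff hden.ne']
      linear_combination (μ - 1) ^ 2 * hsum - (X * (μ - 1) + (μ + d - 1) * Y) * hr
  · intro μ hμ _
    obtain ⟨-, rfl, rfl⟩ := hfin μ hμ
    rw [DeepMatrixFactorization.couplingConst_eq, ← hinv]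
    refine ⟨?_, fun j hj hjn => ?_⟩
    · rw [hσ0]
      refine ⟨hXL, by linarith, ?_⟩
      rw [show (wstar * d - X ^ (k + 2)) / (n - 1) = Y ^ (k + 2) by
        rw [div_eq_iff hnR.ne']; linarith, DeepMatrixFactorization.pow_rpow_eq_inv_pow k hX,
        DeepMatrixFactorization.pow_rpow_eq_inv_pow k hY]
    · rw [hσ j hj hjn]
      refine ⟨hYL, by linarith, ?_⟩
      rw [show wstar * d - (n - 1) * Y ^ (k + 2) = X ^ (k + 2) by linarith,
        DeepMatrixFactorization.pow_rpow_eq_inv_pow k hX,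
        DeepMatrixFactorization.pow_rpow_eq_inv_pow k hY]
  · intro hm' j hj
    have h01 := htop hm'
    subst h01
    -- Equal initial eigenvalues make the conserved quantity trivial, so the limits coincide.
    have hXY : X = Y := by
      rcases Nat.eq_zero_or_pos k with hk | hk
      · exact mul_right_cancel₀ hy.ne' ((hratio hk).trans (mul_comm _ _))
      · rw [sub_self, sub_eq_zero, inv_inj] at hinv
        exact (pow_left_inj₀ hX.le hY.le hk.ne').1 hinv
    subst hXY
    have hval : X ^ (k + 2) = s * wstar := by
      have hdR : (d : ℝ) = s * n := by exact_mod_cast hd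
      have hn0 : (n : ℝ) ≠ 0 := by linarith
      refine mul_left_cancel₀ hn0 ?_
      rw [hdR] at hsum
      linear_combination hsum
    rcases Nat.eq_zero_or_pos j with rfl | hj0
    · rw [hσ0, hval]
    · rw [hσ j hj0 hj, hval]
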